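/- A bicoloured plane tree is a finite tree embedded in the oriented plane, with its vertices properly coloured black and white. Its passport is $[\alpha;\beta;n]$, where $n$ is the number of edges and $\alpha,\beta\vdash n$ are the partitions formed by the degrees of the black and of the white vertices respectively. Its monodromy group (cartographic group) is the group $\langle\sigma_0,\sigma_1\rangle$ of permutations of its $n$ edges, where $\sigma_0$ (respectively $\sigma_1$) sends each edge to the next one in the cyclic order around its black (respectively white) endpoint. Let $r,s\ge 2$, and let $t,p,n$ be non-negative integers with $n=3p=r+s+t$ and $p+t+2=n+1$. Let $G$ be the monodromy group of any bicoloured plane tree with passport $[r,s,1^t;3^p;n]$, that is, with black vertices of degrees $r$ and $s$ together with $t$ black leaves, and with $p$ white vertices, all of degree $3$. (For $r\ne s$ there are two such trees up to isomorphism, and the statement applies to both.) Then $$G\cong\begin{cases}A_p^3\rtimes A_4&\text{if } r\equiv s\equiv 0\pmod 2,\\ A_p^3\rtimes \mathbb Z_3&\text{if } r\equiv s\equiv 1\pmod 2,\\ A_p^3\rtimes(A_4\times\mathbb Z_2)&\text{if } r\not\equiv s\pmod 2,\end{cases}$$ where $A_k$ is the alternating group on $k$ letters, $\mathbb Z_k$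 is the cyclic group of order $k$, and in each case the semidirect product is taken with respect to some action of the right-hand factor on $A_p^3$. -/

import Mathlib

/-- A bicoloured plane tree on the vertex set `V`: a tree with a proper colouring of its vertices
in two colours (`true` is black, `false` is white), together with its embedding in the oriented
plane, recorded by the cyclic order of the neighbours (equivalently, of the edges) around every
vertex. `rot v u` is the neighbour of `v` that follows `u` in the cyclic order around `v`. -/
structure BicolouredPlaneTree (V : Type*) where
  graph : SimpleGraph V
  isTree : graph.IsTree
  colour : graph.Coloring Bool
  rot : (v : V) → Equiv.Perm (graph.neighborSet v)
  rot_isCycleOn : ∀ v, (rot v).IsCycleOn Set.univ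

namespace BicolouredPlaneTree

/-- The edges of the tree, each given as the pair (black end, white end). -/
def Edge {V : Type*} (T : BicolouredPlaneTree V) : Type _ :=
  {x : V × V // T.graph.Adj x.1 x.2 ∧ T.colour x.1 = true}

theorem colour_white_end {V : Type*} (T : BicolouredPlaneTree V) {b w : V}
    (h : T.graph.Adj b w) (hb : T.colour b = true) : T.colour w = false := by
  have := T.colour.valid h
  rw [hb] at this
  simpa using this.symm

theorem colour_black_end {V : Type*} (T : BicolouredPlaneTree V) {b w : V}
    (h : T.graph.Adj w b) (hw : T.colour w = false) : T.colour b = true := by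
  have := T.colour.valid h
  rw [hw] at this
  simpa using this.symm

/-- The permutation of the edges that sends every edge to the next edge around its black end. -/
def sigmaZero {V : Type*} (T : BicolouredPlaneTree V) : Equiv.Perm T.Edge where
  toFun e := ⟨(e.1.1, T.rot e.1.1 ⟨e.1.2, e.2.1⟩),
    (T.rot e.1.1 ⟨e.1.2, e.2.1⟩).2, e.2.2⟩
  invFun e := ⟨(e.1.1, (T.rot e.1.1).symm ⟨e.1.2, e.2.1⟩),
    ((T.rot e.1.1).symm ⟨e.1.2, e.2.1⟩).2, e.2.2⟩
  left_inv e := Subtype.ext (Prod.ext rfl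
    (congrArg Subtype.val ((T.rot e.1.1).symm_apply_apply ⟨e.1.2, e.2.1⟩)))
  right_inv e := Subtype.ext (Prod.ext rfl
    (congrArg Subtype.val ((T.rot e.1.1).apply_symm_apply ⟨e.1.2, e.2.1⟩)))

/-- The permutation of the edges that sends every edge to the next edge around its white end. -/
def sigmaOne {V : Type*} (T : BicolouredPlaneTree V) : Equiv.Perm T.Edge where
  toFun e := ⟨(T.rot e.1.2 ⟨e.1.1, e.2.1.symm⟩, e.1.2),
    SimpleGraph.Adj.symm (T.rot e.1.2 ⟨e.1.1, e.2.1.symm⟩).2,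
    T.colour_black_end (T.rot e.1.2 ⟨e.1.1, e.2.1.symm⟩).2 (T.colour_white_end e.2.1 e.2.2)⟩
  invFun e := ⟨((T.rot e.1.2).symm ⟨e.1.1, e.2.1.symm⟩, e.1.2),
    SimpleGraph.Adj.symm ((T.rot e.1.2).symm ⟨e.1.1, e.2.1.symm⟩).2,
    T.colour_black_end ((T.rot e.1.2).symm ⟨e.1.1, e.2.1.symm⟩).2
      (T.colour_white_end e.2.1 e.2.2)⟩
  left_inv e := Subtype.ext (Prod.ext
    (congrArg Subtype.val ((T.rot e.1.2).symm_apply_apply ⟨e.1.1, e.2.1.symm⟩)) rfl)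
  right_inv e := Subtype.ext (Prod.ext
    (congrArg Subtype.val ((T.rot e.1.2).apply_symm_apply ⟨e.1.1, e.2.1.symm⟩)) rfl)

/-- The monodromy (cartographic) group of the tree: the group of permutations of the edges
generated by the two rotations. -/
def monodromyGroup {V : Type*} (T : BicolouredPlaneTree V) : Subgroup (Equiv.Perm T.Edge) :=
  Subgroup.closure {T.sigmaZero, T.sigmaOne}

open Classical in
/-- The multiset of the degrees of the vertices of colour `c`. -/
noncomputable def degrees {V : Type*} [Fintype V] (T : BicolouredPlaneTree V) (c : Bool) :
    Multiset ℕ :=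
  (Finset.univ.filter fun v => T.colour v = c).val.map fun v => T.graph.degree v

/-- The tree has passport `[α; β; n]`: it has `n` edges, its black vertices have the degrees
listed in `α`, and its white vertices have the degrees listed in `β`. -/
def HasPassport {V : Type*} [Fintype V] (T : BicolouredPlaneTree V) (α β : Multiset ℕ) (n : ℕ) :
    Prop :=
  T.degrees true = α ∧ T.degrees false = β ∧ Nat.card T.Edge = n

end BicolouredPlaneTree

/-- `G` is a semidirect product `N ⋊ K`, for some action of `K` on `N`. -/
def IsSemidirectProductOf (G N K : Type*) [Group G] [Group N] [Group K] : Prop :=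
  ∃ φ : K →* MulAut N, Nonempty (G ≃* N ⋊[φ] K)

/-! Let v₀, v₁ be the black vertices of degrees r, s. A white vertex adjacent to neither would form,
with its leaves, a whole component; so every white vertex is adjacent to v₀ or v₁, and since r + s =
p + 1 exactly one, c, is adjacent to both. Exchanging v₀ and v₁ if necessary, v₁ follows v₀ around
c. The edges can then be labelled by (white end, layer in ℤ/3) with the edges at v₀ in layer 0 and
those at v₁ in layer 1 (`exists_labelling`). Now σ₁ rotates the layers and σ₀ = (a, b, 1), where a
and b are cycles of lengths r and s on the white vertices whose supports cover everything and meet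
only in c. So G is a subgroup of S_p ≀ ℤ/3.

The commutator of (a, b, 1) with its shift (1, a, b) lives in a single layer. Conjugation spreads it
to the commutator subgroup of ⟨a, b⟩, which contains A_p; hence A_p³ ≤ G (`mem_of_shift_mem`). So G
is determined by the sign patterns generated by the shifts of (sign a, sign b, 1): the trivial one,
the even ones, or all (`mem_closure_wreath_iff`). Lifting -1 to the same transposition in every
layer splits off the quotient (sign patterns) ⋊ ℤ/3, which is ℤ/3, A₄ or A₄ × ℤ/2 respectively
(`isSemidirectProductOf_of_mem_iff`). -/

/-! ### Two cycles meeting in one point. -/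

open Equiv Equiv.Perm commutatorElement in
/-- The commutator of two cycles whose supports meet in a single point is a three-cycle. -/
theorem isThreeCycle_commutator_of_support_inter {α : Type*} [Fintype α] [DecidableEq α]
    {a b : Perm α} {c : α} (hac : a c ≠ c) (hbc : b c ≠ c)
    (hab : ∀ z, a z ≠ z → b z ≠ z → z = c) : ⁅a, b⁆.IsThreeCycle := by
  have ha : ∀ z, z ≠ c → b z ≠ z → a z = z := fun z h1 h2 => by
    by_contra h; exact h1 (hab z h h2)
  have hb : ∀ z, z ≠ c → a z ≠ z → b z = z := fun z h1 h2 => by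
    by_contra h; exact h1 (hab z h2 h)
  -- The commutator is (c, b c)(c, a c); clearing the inverses allows a pointwise check.
  have key : ∀ z, a (b z) = (swap c (b c) * swap c (a c)) (b (a z)) := by
    intro z
    have h1 : b (a c) = a c := hb _ hac fun h => hac (a.injective h)
    have h2 : a (b c) = b c := ha _ hbc fun h => hbc (b.injective h)
    have hne : a c ≠ b c := fun h => hac (a.injective (by rw [h, h2]))
    by_cases hz : z = c
    · subst hz
      rw [h1, h2, Perm.mul_apply, swap_apply_right, swap_apply_left]
    by_cases hza : a z = z
    · rw [hza]
      by_cases hzb : b z = c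
      · rw [hzb, Perm.mul_apply, swap_apply_left, swap_apply_of_ne_of_ne hac hne]
      · have h3 : b z ≠ a c := fun h => by
          have : z = a c := b.injective (h.trans h1.symm)
          exact hac (a.injective (by rw [← this, hza]))
        have h4 : b z ≠ b c := fun h => hz (b.injective h)
        rw [Perm.mul_apply, swap_apply_of_ne_of_ne hzb h3, swap_apply_of_ne_of_ne hzb h4]
        by_cases hbz : b z = z
        · rw [hbz, hza]
        · exact ha _ hzb fun h => hbz (b.injective h)
    · have hzb := hb z hz hza
      rw [hzb]
      by_cases hzc : a z = c
      · rw [hzc, Perm.mul_apply, swap_apply_of_ne_of_ne hbc hne.symm, swap_apply_right]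
      · have h3 : b (a z) = a z := hb _ hzc fun h => hza (a.injective h)
        have h4 : a z ≠ a c := fun h => hz (a.injective h)
        have h5 : a z ≠ b c := fun h => by
          exact hbc (b.injective (by rw [← h, h3]))
        rw [h3, Perm.mul_apply, swap_apply_of_ne_of_ne hzc h4, swap_apply_of_ne_of_ne hzc h5]
  have hcomm : ⁅a, b⁆ = swap c (b c) * swap c (a c) := by
    rw [commutatorElement_def, mul_assoc, ← mul_inv_rev, mul_inv_eq_iff_eq_mul]
    ext z
    exact key z
  rw [hcomm]
  refine isThreeCycle_swap_mul_swap_same hbc.symm hac.symm fun h => ?_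
  have h2 : a (b c) = b c := ha _ hbc fun h => hbc (b.injective h)
  exact hac (a.injective (by rw [← h, h2]))

open Equiv Equiv.Perm MulAction Pointwise in
/-- Two cycles whose supports cover the set and meet in a single point generate a primitive
group. -/
theorem isPreprimitive_closure_pair_of_isCycle {α : Type*} {a b : Perm α} {c : α}
    (ha : a.IsCycle) (hb : b.IsCycle) (hac : a c ≠ c) (hbc : b c ≠ c)
    (hab : ∀ z, a z ≠ z → b z ≠ z → z = c) (hcov : ∀ z, a z ≠ z ∨ b z ≠ z) :
    IsPreprimitive (Subgroup.closure {a, b}) α := by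
  set C := Subgroup.closure {a, b} with hC
  have haC : a ∈ C := Subgroup.subset_closure (by simp)
  have hbC : b ∈ C := Subgroup.subset_closure (by simp)
  have htrans : ∀ z, ∃ g : C, g • c = z := by
    intro z
    rcases hcov z with h | h
    · obtain ⟨i, hi⟩ := ha.exists_zpow_eq hac h
      exact ⟨⟨a ^ i, C.zpow_mem haC i⟩, hi⟩
    · obtain ⟨i, hi⟩ := hb.exists_zpow_eq hbc h
      exact ⟨⟨b ^ i, C.zpow_mem hbC i⟩, hi⟩
  have : IsPretransitive C α := (isPretransitive_iff_base c).2 htrans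
  refine IsPreprimitive.of_isTrivialBlock_base c fun {B} hcB hB => ?_
  have step : ∀ g ∈ C, ∀ z ∈ B, g z ∈ B → ∀ y ∈ B, ∀ i : ℤ, (g ^ i) y ∈ B := by
    intro g hg z hz hgz y hy i
    have h1 : (⟨g, hg⟩ : C) • B = B := by
      rw [isBlock_iff_smul_eq_of_nonempty] at hB
      exact hB ⟨g z, ⟨z, hz, rfl⟩, hgz⟩
    have h2 : (⟨g, hg⟩ : C) ∈ stabilizer C B := h1
    have h3 := (stabilizer C B).zpow_mem h2 i
    rw [mem_stabilizer_iff] at h3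
    rw [← h3]
    exact ⟨y, hy, rfl⟩
  -- A fixed point of `a` in the block makes `a` stabilise the block, which contains `c` and hence
  -- the whole cycle through `c`.
  have fullA : (∃ z ∈ B, a z = z) → ∀ y, a y ≠ y → y ∈ B := by
    rintro ⟨z, hz, hzz⟩ y hy
    obtain ⟨i, rfl⟩ := ha.exists_zpow_eq hac hy
    exact step a haC z hz (by rwa [hzz]) c hcB i
  have fullB : (∃ z ∈ B, b z = z) → ∀ y, b y ≠ y → y ∈ B := by
    rintro ⟨z, hz, hzz⟩ y hy
    obtain ⟨i, rfl⟩ := hb.exists_zpow_eq hbc hy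
    exact step b hbC z hz (by rwa [hzz]) c hcB i
  have fixA : a (b c) = b c := by
    by_contra h
    exact hbc (hab _ h fun h => hbc (b.injective h))
  have fixB : b (a c) = a c := by
    by_contra h
    exact hac (hab _ (fun h => hac (a.injective h)) h)
  by_cases hsub : B.Subsingleton
  · exact Or.inl hsub
  right
  have : ∃ z ∈ B, z ≠ c := by
    by_contra! h
    exact hsub fun x hx y hy => (h x hx).trans (h y hy).symm
  obtain ⟨z, hz, hzc⟩ := this
  -- The point `z` is moved by only one cycle, so the block contains the support of the other; the
  -- image of `c` under that other cycle is fixed by the first, so the block contains both supports.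
  have hboth : (∀ y, a y ≠ y → y ∈ B) ∧ (∀ y, b y ≠ y → y ∈ B) := by
    rcases hcov z with h | h
    · have h1 := fullB ⟨z, hz, by by_contra h'; exact hzc (hab z h h')⟩
      exact ⟨fullA ⟨b c, h1 _ fun h => hbc (b.injective h), fixA⟩, h1⟩
    · have h1 := fullA ⟨z, hz, by by_contra h'; exact hzc (hab z h' h)⟩
      exact ⟨h1, fullB ⟨a c, h1 _ fun h => hac (a.injective h), fixB⟩⟩
  exact Set.eq_univ_of_forall fun y => (hcov y).elim (hboth.1 y) (hboth.2 y)

-- A three-cycle g is conjugate to its square: if h g h⁻¹ = g², then ⁅h, g⁆ = g.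
open Equiv Equiv.Perm commutatorElement in
theorem alternatingGroup_le_commutator_perm {α : Type*} [Fintype α] [DecidableEq α] :
    alternatingGroup α ≤ ⁅(⊤ : Subgroup (Perm α)), ⊤⁆ := by
  rw [← closure_three_cycles_eq_alternating, Subgroup.closure_le]
  intro g hg
  obtain ⟨h, hh⟩ := isConj_iff.1 (isConj_iff_cycleType_eq.2
    (hg.cycleType.trans hg.isThreeCycle_sq.cycleType.symm))
  have : g = ⁅h, g⁆ := by
    rw [commutatorElement_def, hh, mul_inv_cancel_right]
  rw [this]
  exact Subgroup.commutator_mem_commutator (Subgroup.mem_top _) (Subgroup.mem_top _)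

open Equiv Equiv.Perm commutatorElement in
/-- A subgroup of `⟨a, b⟩` that is stable under conjugation by `a` and `b` and contains
their commutator contains the commutator subgroup. -/
theorem commutator_closure_pair_le {G : Type*} [Group G] {a b : G} {M : Subgroup G}
    (hM : ∀ x ∈ Subgroup.closure {a, b}, ∀ m ∈ M, x * m * x⁻¹ ∈ M) (hab : ⁅a, b⁆ ∈ M) :
    ⁅Subgroup.closure {a, b}, Subgroup.closure {a, b}⁆ ≤ M := by
  set C := Subgroup.closure {a, b}
  have inv_step : ∀ y z : G, ⁅y, z⁆ ∈ M → ⁅z, y⁆ ∈ M := fun y z h => by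
    rw [← commutatorElement_inv]; exact M.inv_mem h
  have mul_step : ∀ x y z : G, x ∈ C → ⁅x, z⁆ ∈ M → ⁅y, z⁆ ∈ M → ⁅x * y, z⁆ ∈ M := by
    intro x y z hx h1 h2
    have : ⁅x * y, z⁆ = x * ⁅y, z⁆ * x⁻¹ * ⁅x, z⁆ := by
      simp only [commutatorElement_def]; group
    rw [this]
    exact M.mul_mem (hM x hx _ h2) h1
  have closure_step : ∀ z, ⁅a, z⁆ ∈ M → ⁅b, z⁆ ∈ M → ∀ x ∈ C, ⁅x, z⁆ ∈ M := by
    intro z h1 h2 x hx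
    induction hx using Subgroup.closure_induction with
    | mem x hx => rcases hx with rfl | rfl <;> assumption
    | one => rw [commutatorElement_one_left]; exact M.one_mem
    | mul x y hx _ ihx ihy => exact mul_step x y z hx ihx ihy
    | inv x hx ih =>
      have : ⁅x⁻¹, z⁆ = x⁻¹ * ⁅x, z⁆⁻¹ * x⁻¹⁻¹ := by simp only [commutatorElement_def]; group
      rw [this]
      exact hM _ (C.inv_mem hx) _ (M.inv_mem ih)
  rw [Subgroup.commutator_le]
  intro x hx z hz
  -- The induction on words is run once in each argument of the commutator.
  refine closure_step z (inv_step _ _ ?_) (inv_step _ _ ?_) x hx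
  · exact closure_step a (by rw [commutatorElement_self]; exact M.one_mem) (inv_step _ _ hab) z hz
  · exact closure_step b hab (by rw [commutatorElement_self]; exact M.one_mem) z hz

open Equiv Equiv.Perm commutatorElement in
/-- The commutator subgroup of the group generated by two cycles whose supports cover the set and
meet in a single point contains the alternating group. -/
theorem alternatingGroup_le_commutator_closure_pair {α : Type*} [Fintype α] [DecidableEq α]
    {a b : Perm α} {c : α} (ha : a.IsCycle) (hb : b.IsCycle) (hac : a c ≠ c) (hbc : b c ≠ c)
    (hab : ∀ z, a z ≠ z → b z ≠ z → z = c) (hcov : ∀ z, a z ≠ z ∨ b z ≠ z) :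
    alternatingGroup α ≤ ⁅Subgroup.closure {a, b}, Subgroup.closure {a, b}⁆ := by
  set C := Subgroup.closure {a, b}
  have haC : a ∈ C := Subgroup.subset_closure (by simp)
  have hbC : b ∈ C := Subgroup.subset_closure (by simp)
  -- Jordan's theorem: a primitive group containing a three-cycle contains the alternating group.
  have hAC : alternatingGroup α ≤ C :=
    alternatingGroup_le_of_isPreprimitive_of_isThreeCycle_mem
      (isPreprimitive_closure_pair_of_isCycle ha hb hac hbc hab hcov)
      (isThreeCycle_commutator_of_support_inter hac hbc hab)
      (by rw [commutatorElement_def]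
          exact C.mul_mem (C.mul_mem (C.mul_mem haC hbC) (C.inv_mem haC)) (C.inv_mem hbC))
  -- The alternating group is perfect only from degree 5 on. With an odd element, `C` is the full
  -- symmetric group and the degree does not matter; otherwise both cycles have length at least 3
  -- and share one point, so the degree is at least 5.
  by_cases hodd : ∃ g ∈ C, sign g ≠ 1
  · obtain ⟨g, hg, hs⟩ := hodd
    have : C = ⊤ := by
      rw [eq_top_iff]
      intro x _
      rcases Int.units_eq_one_or (sign x) with h | h
      · exact hAC (mem_alternatingGroup.2 h)
      · have h1 : x * g ∈ C := hAC (mem_alternatingGroup.2 (by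
          rw [Perm.sign_mul, h, (Int.units_eq_one_or (sign g)).resolve_left hs]; rfl))
        exact (Subgroup.mul_mem_cancel_right C hg).1 h1
    rw [this]
    exact alternatingGroup_le_commutator_perm
  · push Not at hodd
    have three_le : ∀ g ∈ C, g.IsCycle → 3 ≤ g.support.card := by
      intro g hg hcyc
      have h1 := hodd g hg
      rw [hcyc.sign] at h1
      have h2 := hcyc.two_le_card_support
      rcases h2.eq_or_lt with h | h
      · rw [← h] at h1; exact absurd h1 (by decide)
      · exact h
    have hinter : a.support ∩ b.support = {c} := by
      ext z
      simp only [Finset.mem_inter, mem_support, Finset.mem_singleton]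
      exact ⟨fun h => hab z h.1 h.2, fun h => h ▸ ⟨hac, hbc⟩⟩
    have hunion : a.support ∪ b.support = Finset.univ := by
      ext z
      simpa using hcov z
    have hcard := Finset.card_union_add_card_inter a.support b.support
    rw [hinter, hunion, Finset.card_univ, Finset.card_singleton] at hcard
    have h5 : 5 ≤ Nat.card α := by
      rw [Nat.card_eq_fintype_card]
      have := three_le a haC ha
      have := three_le b hbC hb
      omega
    calc alternatingGroup α = ⁅alternatingGroup α, alternatingGroup α⁆ :=
          (commutator_alternatingGroup_eq_self h5).symm
      _ ≤ _ := Subgroup.commutator_mono hAC hAC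

/-! ### The wreath product with ℤ/3 and the sign patterns. -/

/-- The cyclic shift of a triple. -/
def shift {M : Type*} (j : Fin 3) (f : Fin 3 → M) : Fin 3 → M := fun i => f (i + j)

open Equiv Equiv.Perm in
/-- The element of the wreath product `Perm W ≀ ℤ/3` that acts by `f i` on the `i`-th layer and
then moves every layer `j` steps further. -/
def wreathPerm {W : Type*} (f : Fin 3 → Perm W) (j : Fin 3) : Perm (W × Fin 3) where
  toFun x := (f x.2 x.1, x.2 + j)
  invFun y := ((f (y.2 - j))⁻¹ y.1, y.2 - j)
  left_inv x := by simp
  right_inv x := by simp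

section Wreath

open Equiv Equiv.Perm

variable {W : Type*}

theorem wreathPerm_apply (f : Fin 3 → Perm W) (j : Fin 3) (x : W × Fin 3) :
    wreathPerm f j x = (f x.2 x.1, x.2 + j) := rfl

/-- The right factor acts first and has already moved the layers by `l` when `f` acts, whence the
shift of `f`. -/
theorem wreathPerm_mul (f g : Fin 3 → Perm W) (j l : Fin 3) :
    wreathPerm f j * wreathPerm g l = wreathPerm (shift l f * g) (l + j) := by
  ext x <;> simp [wreathPerm_apply, shift, add_assoc]

theorem wreathPerm_one_zero : wreathPerm (1 : Fin 3 → Perm W) 0 = 1 := by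
  ext x <;> simp [wreathPerm_apply]

theorem shift_zero {M : Type*} (f : Fin 3 → M) : shift 0 f = f := by
  funext i; simp [shift]

theorem wreathPerm_inv (f : Fin 3 → Perm W) (j : Fin 3) :
    (wreathPerm f j)⁻¹ = wreathPerm (shift (-j) f⁻¹) (-j) := by
  rw [inv_eq_iff_mul_eq_one, wreathPerm_mul, ← wreathPerm_one_zero, neg_add_cancel]
  congr 1
  funext i
  simp [shift]

theorem wreathPerm_injective [Nonempty W] {f g : Fin 3 → Perm W} {j l : Fin 3}
    (h : wreathPerm f j = wreathPerm g l) : f = g ∧ j = l := by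
  constructor
  · funext i
    ext w
    exact congrArg Prod.fst (DFunLike.congr_fun h (w, i))
  · obtain ⟨w⟩ := ‹Nonempty W›
    simpa [wreathPerm_apply] using congrArg Prod.snd (DFunLike.congr_fun h (w, 0))

/-- The base group of the wreath product. -/
def wreathBase (W : Type*) : (Fin 3 → Perm W) →* Perm (W × Fin 3) where
  toFun f := wreathPerm f 0
  map_one' := wreathPerm_one_zero
  map_mul' f g := by rw [wreathPerm_mul, shift_zero, add_zero]

theorem wreathBase_apply (f : Fin 3 → Perm W) : wreathBase W f = wreathPerm f 0 := rfl

theorem wreathPerm_eq_mul (f : Fin 3 → Perm W) (j : Fin 3) :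
    wreathPerm f j = wreathPerm 1 j * wreathPerm f 0 := by
  rw [wreathPerm_mul, zero_add]
  congr 1

open commutatorElement in
/-- A shift-stable subgroup of `Perm W ^ 3` containing `(a, b, 1)` contains the third power of the
alternating group. -/
theorem mem_of_shift_mem [Fintype W] [DecidableEq W] {B : Subgroup (Fin 3 → Perm W)}
    (hB : ∀ f ∈ B, ∀ j, shift j f ∈ B) {a b : Perm W} {c : W}
    (ha : a.IsCycle) (hb : b.IsCycle) (hac : a c ≠ c) (hbc : b c ≠ c)
    (hab : ∀ z, a z ≠ z → b z ≠ z → z = c) (hcov : ∀ z, a z ≠ z ∨ b z ≠ z)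
    (h : ![a, b, 1] ∈ B) {f : Fin 3 → Perm W} (hf : ∀ i, f i ∈ alternatingGroup W) : f ∈ B := by
  -- `M` consists of the m with (1, m, 1) in `B`, and `h'` is about the triple (1, a, b). Layer 1 of
  -- these two triples shows `b` and `a`, so `M` is stable under conjugation by ⟨a, b⟩.
  set M := B.comap (MonoidHom.mulSingle (fun _ : Fin 3 => Perm W) 1) with hM
  have h' := hB _ h 2
  have hproj : Subgroup.closure {a, b} ≤ B.map (Pi.evalMonoidHom _ 1) := by
    rw [Subgroup.closure_le]
    rintro x (rfl | rfl)
    · exact ⟨_, h', rfl⟩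
    · exact ⟨_, h, rfl⟩
  have hconj : ∀ x ∈ Subgroup.closure {a, b}, ∀ m ∈ M, x * m * x⁻¹ ∈ M := by
    intro x hx m hm
    obtain ⟨g, hg, rfl⟩ := hproj hx
    have h1 := B.mul_mem (B.mul_mem hg hm) (B.inv_mem hg)
    rw [hM, Subgroup.mem_comap]
    convert h1 using 1
    funext i
    by_cases hi : i = 1
    · subst hi; simp
    · simp [hi]
  have hcomm : ⁅a, b⁆ ∈ M := by
    rw [← commutatorElement_inv]
    refine M.inv_mem ?_
    -- The commutator of (a, b, 1) and (1, a, b) is (1, ⁅b, a⁆, 1).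
    have h1 := B.mul_mem (B.mul_mem (B.mul_mem h h') (B.inv_mem h)) (B.inv_mem h')
    rw [hM, Subgroup.mem_comap]
    convert h1 using 1
    funext i
    fin_cases i <;> simp [shift, commutatorElement_def]
  have halt : alternatingGroup W ≤ M :=
    (alternatingGroup_le_commutator_closure_pair ha hb hac hbc hab hcov).trans
      (commutator_closure_pair_le hconj hcomm)
  refine Subgroup.pi_mem_of_mulSingle_mem _ fun i => ?_
  have h1 := hB _ (halt (hf i)) (1 - i)
  convert h1 using 1
  funext k
  by_cases hk : k = i
  · subst hk; simp [shift]
  · have : k + (1 - i) ≠ 1 :=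
      (by decide : ∀ k i : Fin 3, k ≠ i → k + (1 - i) ≠ 1) k i hk
    simp [shift, hk, this]

/-- The elements of the group generated by `(a, b, 1)` and the rotation of the layers, in terms of
the signs of the permutations of the layers. -/
theorem mem_closure_wreath_iff [Fintype W] [DecidableEq W] {a b : Perm W} {c : W}
    (ha : a.IsCycle) (hb : b.IsCycle) (hac : a c ≠ c) (hbc : b c ≠ c)
    (hab : ∀ z, a z ≠ z → b z ≠ z → z = c) (hcov : ∀ z, a z ≠ z ∨ b z ≠ z)
    {L : Subgroup (Fin 3 → ℤˣ)} (hL : ∀ v ∈ L, ∀ j, shift j v ∈ L)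
    (hs : ![sign a, sign b, 1] ∈ L)
    (hmin : ∀ v ∈ L, ∃ x y z : Fin 2, v = ![sign a, sign b, 1] ^ x.1 *
      shift 1 ![sign a, sign b, 1] ^ y.1 * shift 2 ![sign a, sign b, 1] ^ z.1)
    (g : Perm (W × Fin 3)) :
    g ∈ Subgroup.closure {wreathPerm ![a, b, 1] 0, wreathPerm 1 1} ↔
      ∃ f j, (fun i => sign (f i)) ∈ L ∧ g = wreathPerm f j := by
  set G := Subgroup.closure {wreathPerm ![a, b, 1] 0, wreathPerm 1 1}
  have h0 : wreathPerm ![a, b, 1] 0 ∈ G := Subgroup.subset_closure (by simp)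
  have h1 : wreathPerm 1 1 ∈ G := Subgroup.subset_closure (by simp)
  constructor
  · intro hg
    induction hg using Subgroup.closure_induction with
    | mem x hx =>
      rcases hx with rfl | rfl
      · refine ⟨_, _, ?_, rfl⟩
        convert hs using 1
        funext i; fin_cases i <;> simp
      · refine ⟨_, _, ?_, rfl⟩
        convert L.one_mem using 1
        funext i; simp
    | one => exact ⟨1, 0, by convert L.one_mem using 1; funext i; simp, wreathPerm_one_zero.symm⟩
    | mul x y _ _ ihx ihy =>
      obtain ⟨f, j, hf, rfl⟩ := ihx
      obtain ⟨f', j', hf', rfl⟩ := ihy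
      refine ⟨_, _, ?_, wreathPerm_mul ..⟩
      convert L.mul_mem (hL _ hf j') hf' using 1
      funext i
      simp [shift]
    | inv x _ ih =>
      obtain ⟨f, j, hf, rfl⟩ := ih
      refine ⟨_, _, ?_, wreathPerm_inv ..⟩
      convert hL _ (L.inv_mem hf) (-j) using 1
      funext i
      simp [shift]
  · rintro ⟨f, j, hf, rfl⟩
    have hrot : ∀ j, wreathPerm 1 j ∈ G := by
      have h2 : wreathPerm 1 2 ∈ G := by
        have := G.mul_mem h1 h1
        rwa [wreathPerm_mul] at this
      intro j
      fin_cases j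
      · exact wreathPerm_one_zero (W := W) ▸ G.one_mem
      · exact h1
      · exact h2
    rw [wreathPerm_eq_mul]
    refine G.mul_mem (hrot j) ?_
    set B := G.comap (wreathBase W)
    have hB : ∀ f ∈ B, ∀ j, shift j f ∈ B := by
      intro f hf j
      have h2 := G.mul_mem (G.mul_mem (G.inv_mem (hrot j)) hf) (hrot j)
      rw [wreathBase_apply, wreathPerm_inv, wreathPerm_mul, wreathPerm_mul] at h2
      change wreathPerm _ _ ∈ G
      convert h2 using 2
      · funext i; simp [shift]
      · simp
    have halt := fun f => mem_of_shift_mem hB ha hb hac hbc hab hcov h0 (f := f)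
    change f ∈ B
    obtain ⟨x, y, z, hxyz⟩ := hmin _ hf
    -- The word that `hmin` gives for the signs of `f`, read in the permutations themselves: `q` has
    -- the signs of `f`, so f q⁻¹ is even in every layer.
    set q : Fin 3 → Perm W := ![a, b, 1] ^ x.1 * shift 1 ![a, b, 1] ^ y.1 * shift 2 ![a, b, 1] ^ z.1
    have hq : q ∈ B := B.mul_mem (B.mul_mem (B.pow_mem h0 _) (B.pow_mem (hB _ h0 1) _))
      (B.pow_mem (hB _ h0 2) _)
    have hsq : ∀ i, sign (q i) = sign (f i) := by
      intro i
      have h3 : ∀ k, sign ((![a, b, 1] : Fin 3 → Perm W) k) = ![sign a, sign b, 1] k := by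
        intro k; fin_cases k <;> simp
      rw [show sign (f i) = _ from congrFun hxyz i]
      simp only [q, Pi.mul_apply, Pi.pow_apply, Perm.sign_mul, map_pow, shift, h3]
    refine (Subgroup.mul_mem_cancel_right B (B.inv_mem hq)).1 (halt _ fun i => ?_)
    rw [mem_alternatingGroup]
    simp [hsq, Int.units_mul_self]

end Wreath

/-! ### Splitting off the cube of the alternating group. -/

/-- A group with an embedded normal subgroup `N` and an embedded complement `K` is a semidirect
product `N ⋊ K`. -/
theorem isSemidirectProductOf_of_complement {G N K : Type*} [Group G] [Group N] [Group K]
    (ι : N →* G) (θ : K →* G) (hnormal : ι.range.Normal)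
    (hinj : ∀ n k, ι n * θ k = 1 → n = 1 ∧ k = 1) (hsurj : ∀ g, ∃ n k, g = ι n * θ k) :
    IsSemidirectProductOf G N K := by
  have hι : Function.Injective ι := (injective_iff_map_eq_one ι).2 fun n hn =>
    (hinj n 1 (by rw [hn, map_one, one_mul])).1
  have hθ : Function.Injective θ := (injective_iff_map_eq_one θ).2 fun k hk =>
    (hinj 1 k (by rw [hk, map_one, one_mul])).2
  have hcompl : Subgroup.IsComplement' ι.range θ.range := by
    refine Subgroup.isComplement'_of_disjoint_and_mul_eq_univ ?_ ?_
    · rw [Subgroup.disjoint_def]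
      rintro _ ⟨n, rfl⟩ ⟨k, hk⟩
      have := (hinj n k⁻¹ (by rw [map_inv, hk, mul_inv_cancel])).1
      rw [this, map_one]
    · refine Set.eq_univ_of_forall fun g => ?_
      obtain ⟨n, k, rfl⟩ := hsurj g
      exact ⟨ι n, ⟨n, rfl⟩, θ k, ⟨k, rfl⟩, rfl⟩
  exact ⟨_, ⟨(SemidirectProduct.mulEquivSubgroup hcompl).symm.trans
    (SemidirectProduct.congr' (MonoidHom.ofInjective hι).symm (MonoidHom.ofInjective hθ).symm)⟩⟩

open Equiv Equiv.Perm in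
/-- The homomorphism from `{1, -1}` that sends `-1` to a transposition. -/
def signSection {W : Type*} [DecidableEq W] (x y : W) : ℤˣ →* Perm W where
  toFun u := if u = 1 then 1 else swap x y
  map_one' := if_pos rfl
  map_mul' u v := by
    rcases Int.units_eq_one_or u with rfl | rfl <;> rcases Int.units_eq_one_or v with rfl | rfl <;>
      simp

open Equiv Equiv.Perm in
theorem sign_signSection {W : Type*} [Fintype W] [DecidableEq W] {x y : W} (h : x ≠ y) (u : ℤˣ) :
    sign (signSection x y u) = u := by
  rcases Int.units_eq_one_or u with rfl | rfl
  · simp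
  · change sign (if (-1 : ℤˣ) = 1 then 1 else swap x y) = -1
    rw [if_neg (by decide), sign_swap h]

open Equiv Equiv.Perm in
/-- A subgroup of `Perm W ≀ ℤ/3` given by a condition on signs is a semidirect product of
`Alt W ^ 3` and the group `K` of the sign patterns that occur. -/
theorem isSemidirectProductOf_of_mem_iff {W K : Type*} [Fintype W] [DecidableEq W] [Nontrivial W]
    [Group K] {G : Subgroup (Perm (W × Fin 3))} {L : Subgroup (Fin 3 → ℤˣ)}
    (hG : ∀ g, g ∈ G ↔ ∃ f j, (fun i => sign (f i)) ∈ L ∧ g = wreathPerm f j)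
    (ρ : K → Fin 3) (ε : K → Fin 3 → ℤˣ) (hρ : ∀ k l, ρ (k * l) = ρ k + ρ l)
    (hε : ∀ k l, ε (k * l) = shift (ρ l) (ε k) * ε l)
    (hfaithful : ∀ k, ρ k = 0 → ε k = 1 → k = 1) (hεL : ∀ k, ε k ∈ L)
    (hsurj : ∀ v ∈ L, ∀ j, ∃ k, ρ k = j ∧ ε k = v) :
    IsSemidirectProductOf G (Fin 3 → alternatingGroup W) K := by
  obtain ⟨x, y, hxy⟩ := exists_pair_ne W
  have : Nonempty W := ⟨x⟩
  have hcoe : ∀ n : Fin 3 → alternatingGroup W, (fun i => sign (n i : Perm W)) = 1 := fun n =>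
    funext fun i => mem_alternatingGroup.1 (n i).2
  let ι : (Fin 3 → alternatingGroup W) →* G :=
    ((wreathBase W).comp (MonoidHom.compLeft (alternatingGroup W).subtype (Fin 3))).codRestrict G
      fun n => (hG _).2 ⟨fun i => n i, 0, by rw [hcoe]; exact L.one_mem, rfl⟩
  have hι : ∀ n, (ι n : Perm (W × Fin 3)) = wreathPerm (fun i => n i) 0 := fun n => rfl
  -- Using the same transposition in all layers makes the lift commute with the shift, hence
  -- multiplicative.
  let lift : K → Perm (W × Fin 3) := fun k => wreathPerm (fun i => signSection x y (ε k i)) (ρ k)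
  have hlift : ∀ k, lift k ∈ G := fun k => (hG _).2
    ⟨_, _, by simpa only [sign_signSection hxy] using hεL k, rfl⟩
  let θ : K →* G := MonoidHom.mk' (fun k => ⟨lift k, hlift k⟩) fun k l => Subtype.ext (by
    change lift (k * l) = lift k * lift l
    simp only [lift, wreathPerm_mul, hρ, hε]
    congr 1
    · funext i
      simp [shift]
    · exact add_comm _ _)
  have hθ : ∀ k, (θ k : Perm (W × Fin 3)) =
      wreathPerm (fun i => signSection x y (ε k i)) (ρ k) := fun k => rfl
  have hrange : ∀ (f : Fin 3 → Perm W), (∀ i, sign (f i) = 1) →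
      ∃ n : Fin 3 → alternatingGroup W, (ι n : Perm (W × Fin 3)) = wreathPerm f 0 := fun f hf =>
    ⟨fun i => ⟨f i, mem_alternatingGroup.2 (hf i)⟩, rfl⟩
  refine isSemidirectProductOf_of_complement ι θ ⟨?_⟩ ?_ ?_
  · rintro _ ⟨n, rfl⟩ ⟨g, hg⟩
    obtain ⟨f, j, -, rfl⟩ := (hG _).1 hg
    obtain ⟨m, hm⟩ := hrange (shift (-j) (f * (fun i => (n i : Perm W)) * f⁻¹)) (by
      intro i
      have := congrFun (hcoe n) (i + -j)
      simp only [Pi.one_apply] at this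
      simp [shift, this])
    refine ⟨m, Subtype.ext ?_⟩
    rw [hm]
    change _ = wreathPerm f j * ι n * (wreathPerm f j)⁻¹
    rw [hι, wreathPerm_inv, wreathPerm_mul, wreathPerm_mul]
    congr 1
    · funext i; simp [shift]
    · simp
  · intro n k h
    have h1 : (ι n : Perm (W × Fin 3)) * θ k = 1 := congrArg Subtype.val h
    rw [hι, hθ, wreathPerm_mul, ← wreathPerm_one_zero] at h1
    obtain ⟨h2, h3⟩ := wreathPerm_injective h1
    rw [add_zero] at h3
    rw [h3, shift_zero] at h2
    have hk : ε k = 1 := by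
      funext i
      have h4 := congrArg sign (congrFun h2 i)
      have h5 := congrFun (hcoe n) i
      simp only [Pi.one_apply] at h5
      simpa [sign_signSection hxy, h5] using h4
    have hk1 := hfaithful k h3 hk
    refine ⟨?_, hk1⟩
    funext i
    refine Subtype.ext ?_
    have h4 := congrFun h2 i
    simpa [hk] using h4
  · rintro ⟨g, hg⟩
    obtain ⟨f, j, hf, rfl⟩ := (hG _).1 hg
    obtain ⟨k, rfl, hk⟩ := hsurj _ hf j
    -- The factor from the base stands to the left of `θ k`, so it gets shifted by `ρ k` in the
    -- product; the shift by `-(ρ k)` compensates.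
    obtain ⟨n, hn⟩ := hrange
      (shift (-(ρ k)) (f * (fun i => signSection x y (ε k i))⁻¹)) (by
        intro i
        simp [shift, hk, sign_signSection hxy, Int.units_mul_self])
    refine ⟨n, k, Subtype.ext ?_⟩
    change _ = (ι n : Perm (W × Fin 3)) * θ k
    rw [hn, hθ, wreathPerm_mul]
    change wreathPerm f (ρ k) = _
    congr 1
    · funext i; simp [shift]
    · simp

/-! ### The complements ℤ/3, A₄ and A₄ × ℤ/2. -/

section Complements

/-- The three nontrivial characters of the Klein four-group, as functions on `Fin 4`. -/
def kleinCharacter : Fin 3 → Fin 4 → ℤˣ :=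
  ![![1, 1, -1, -1], ![1, -1, 1, -1], ![1, -1, -1, 1]]

/-- The sign with which an element of `A₄` carries the character `i` to another one. -/
def altFourSign (g : alternatingGroup (Fin 4)) (i : Fin 3) : ℤˣ :=
  kleinCharacter i ((g⁻¹ : Equiv.Perm (Fin 4)) 0)

/-- The rotation by which an element of `A₄` permutes the three characters. -/
def altFourRotation (g : alternatingGroup (Fin 4)) : Fin 3 :=
  if ∀ x, kleinCharacter 0 ((g⁻¹ : Equiv.Perm (Fin 4)) x) = altFourSign g 0 * kleinCharacter 0 x
  then 0
  else if ∀ x, kleinCharacter 0 ((g⁻¹ : Equiv.Perm (Fin 4)) x) =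
    altFourSign g 0 * kleinCharacter 1 x then 1
  else 2

/-- A₄ permutes the characters cyclically up to sign: χᵢ ∘ g⁻¹ = ± χⱼ with j = i + `altFourRotation
g`, and the sign is the value at 0 because χⱼ(0) = 1. Composing two such relations gives this law
and the twisted one for the signs. -/
theorem altFourRotation_mul : ∀ g h : alternatingGroup (Fin 4),
    altFourRotation (g * h) = altFourRotation g + altFourRotation h := by decide +kernel

theorem altFourSign_mul : ∀ g h : alternatingGroup (Fin 4),
    altFourSign (g * h) = shift (altFourRotation h) (altFourSign g) * altFourSign h := by
  decide +kernel

/-- The product of the three characters is constantly 1. -/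
theorem prod_altFourSign : ∀ g : alternatingGroup (Fin 4), ∏ i, altFourSign g i = 1 := by
  decide +kernel

theorem altFour_eq_one : ∀ g : alternatingGroup (Fin 4), altFourRotation g = 0 →
    altFourSign g = 1 → g = 1 := by decide +kernel

/-- With `altFour_eq_one`, the 12 elements of A₄ inject into the 3 · 4 pairs of a rotation and an
even sign pattern, so every pair occurs. -/
theorem exists_altFour : ∀ v : Fin 3 → ℤˣ, ∏ i, v i = 1 → ∀ j, ∃ g : alternatingGroup (Fin 4),
    altFourRotation g = j ∧ altFourSign g = v := by decide +kernel

open Equiv Equiv.Perm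

variable {W : Type*} [Fintype W] [DecidableEq W] {a b : Perm W} {c : W}

theorem isSemidirectProductOf_of_sign_eq_one (ha : a.IsCycle) (hb : b.IsCycle) (hac : a c ≠ c)
    (hbc : b c ≠ c) (hab : ∀ z, a z ≠ z → b z ≠ z → z = c) (hcov : ∀ z, a z ≠ z ∨ b z ≠ z)
    (hsa : sign a = 1) (hsb : sign b = 1) :
    IsSemidirectProductOf (Subgroup.closure {wreathPerm ![a, b, 1] 0, wreathPerm 1 1})
      (Fin 3 → alternatingGroup W) (Multiplicative (ZMod 3)) := by
  have : Nontrivial W := ⟨_, _, hac⟩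
  refine isSemidirectProductOf_of_mem_iff (L := ⊥)
    (mem_closure_wreath_iff ha hb hac hbc hab hcov ?_ ?_ ?_)
    (fun k : Multiplicative (ZMod 3) => k.toAdd) (fun _ => 1) (fun _ _ => rfl) (fun _ _ => rfl)
    (fun k hk _ => hk) (fun _ => Subgroup.one_mem _) fun v hv j => ⟨.ofAdd j, rfl, ?_⟩
  · rintro _ rfl j; rfl
  · rw [hsa, hsb, Subgroup.mem_bot]; decide
  · rintro v rfl
    exact ⟨0, 0, 0, by simp⟩
  · exact ((Subgroup.mem_bot).1 hv).symm

/-- The sign patterns with an even number of minus signs. -/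
def evenSigns : Subgroup (Fin 3 → ℤˣ) where
  carrier := {v | ∏ i, v i = 1}
  one_mem' := by simp
  mul_mem' {u v} hu hv := by
    rw [Set.mem_ofPred_eq] at *
    simp [Finset.prod_mul_distrib, hu, hv]
  inv_mem' {u} hu := by
    rw [Set.mem_ofPred_eq] at *
    simp [hu]

/-- The shifts of (-1, -1, 1) generate the even patterns, a Klein four-group on which ℤ/3 acts as in
A₄. -/
theorem isSemidirectProductOf_of_sign_eq_neg_one (ha : a.IsCycle) (hb : b.IsCycle) (hac : a c ≠ c)
    (hbc : b c ≠ c) (hab : ∀ z, a z ≠ z → b z ≠ z → z = c) (hcov : ∀ z, a z ≠ z ∨ b z ≠ z)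
    (hsa : sign a = -1) (hsb : sign b = -1) :
    IsSemidirectProductOf (Subgroup.closure {wreathPerm ![a, b, 1] 0, wreathPerm 1 1})
      (Fin 3 → alternatingGroup W) (alternatingGroup (Fin 4)) := by
  have : Nontrivial W := ⟨_, _, hac⟩
  refine isSemidirectProductOf_of_mem_iff (L := evenSigns)
    (mem_closure_wreath_iff ha hb hac hbc hab hcov ?_ ?_ ?_)
    altFourRotation altFourSign altFourRotation_mul altFourSign_mul altFour_eq_one
    prod_altFourSign exists_altFour
  · exact (by decide : ∀ v : Fin 3 → ℤˣ, ∏ i, v i = 1 → ∀ j, ∏ i, shift j v i = 1)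
  · rw [hsa, hsb]
    exact (by decide : ∏ i, (![-1, -1, 1] : Fin 3 → ℤˣ) i = 1)
  · rw [hsa, hsb]
    exact (by decide +kernel : ∀ v : Fin 3 → ℤˣ, ∏ i, v i = 1 → ∃ x y z : Fin 2,
      v = ![-1, -1, 1] ^ x.1 * shift 1 ![-1, -1, 1] ^ y.1 * shift 2 ![-1, -1, 1] ^ z.1)

/-- The sign of an element of `ℤ/2`. -/
def zmodTwoSign (z : Multiplicative (ZMod 2)) : ℤˣ := if z = 1 then 1 else -1

theorem zmodTwoSign_mul : ∀ y z, zmodTwoSign (y * z) = zmodTwoSign y * zmodTwoSign z := by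
  decide +kernel

/-- A single -1 and its shifts generate all patterns. Since 3 is odd, these are the even patterns
times the shift-invariant ±(1, 1, 1), which supplies the factor ℤ/2. -/
theorem isSemidirectProductOf_of_sign_ne (ha : a.IsCycle) (hb : b.IsCycle) (hac : a c ≠ c)
    (hbc : b c ≠ c) (hab : ∀ z, a z ≠ z → b z ≠ z → z = c) (hcov : ∀ z, a z ≠ z ∨ b z ≠ z)
    (hsab : sign a ≠ sign b) :
    IsSemidirectProductOf (Subgroup.closure {wreathPerm ![a, b, 1] 0, wreathPerm 1 1})
      (Fin 3 → alternatingGroup W) (alternatingGroup (Fin 4) × Multiplicative (ZMod 2)) := by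
  have : Nontrivial W := ⟨_, _, hac⟩
  refine isSemidirectProductOf_of_mem_iff (L := ⊤)
    (mem_closure_wreath_iff ha hb hac hbc hab hcov (fun _ _ _ => Subgroup.mem_top _)
      (Subgroup.mem_top _) ?_)
    (fun k : alternatingGroup (Fin 4) × Multiplicative (ZMod 2) => altFourRotation k.1)
    (fun k i => altFourSign k.1 i * zmodTwoSign k.2) (fun k l => altFourRotation_mul k.1 l.1)
    (fun k l => ?_) ?_ (fun _ => Subgroup.mem_top _) ?_
  · exact fun v _ => (by decide +kernel : ∀ (s t : ℤˣ), s ≠ t → ∀ v : Fin 3 → ℤˣ,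
      ∃ x y z : Fin 2, v = ![s, t, 1] ^ x.1 * shift 1 ![s, t, 1] ^ y.1 *
        shift 2 ![s, t, 1] ^ z.1) _ _ hsab v
  · funext i
    have h := congrFun (altFourSign_mul k.1 l.1) i
    rw [Pi.mul_apply] at h
    simp only [Prod.fst_mul, Prod.snd_mul, zmodTwoSign_mul, h, Pi.mul_apply, shift]
    exact mul_mul_mul_comm _ _ _ _
  · rintro ⟨g, z⟩ hg hz
    have h1 := prod_altFourSign g
    have h2 : ∏ i : Fin 3, (altFourSign g i * zmodTwoSign z) = 1 :=
      Finset.prod_eq_one fun i _ => congrFun hz i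
    rw [Finset.prod_mul_distrib, h1, one_mul] at h2
    have h3 : z = 1 := (by decide +kernel : ∀ z, ∏ _i : Fin 3, zmodTwoSign z = 1 → z = 1) z h2
    subst h3
    have h4 : altFourSign g = 1 := by
      funext i
      simpa [zmodTwoSign] using congrFun hz i
    rw [altFour_eq_one g hg h4]
    rfl
  · intro v _ j
    -- `z` carries the product of the three signs of `v`; removing it from each entry leaves an even
    -- pattern.
    obtain ⟨z, hz⟩ : ∃ z, ∏ i, (v i * zmodTwoSign z) = 1 :=
      (by decide +kernel : ∀ v : Fin 3 → ℤˣ, ∃ z, ∏ i, (v i * zmodTwoSign z) = 1) v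
    obtain ⟨g, hg, hgv⟩ := exists_altFour _ hz j
    refine ⟨(g, z), hg, ?_⟩
    funext i
    simp only [congrFun hgv i, mul_assoc, Int.units_mul_self, mul_one]

end Complements

theorem IsSemidirectProductOf.congr {G G' N N' K : Type*} [Group G] [Group G'] [Group N]
    [Group N'] [Group K] (h : IsSemidirectProductOf G N K) (e : G' ≃* G) (f : N ≃* N') :
    IsSemidirectProductOf G' N' K := by
  obtain ⟨φ, ⟨g⟩⟩ := h
  exact ⟨_, ⟨(e.trans g).trans (SemidirectProduct.congr' f (MulEquiv.refl K))⟩⟩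

/-! ### From the tree to the wreath product. -/

/-- A set of vertices that is closed under adjacency contains everything reachable from it. -/
theorem SimpleGraph.Reachable.mem_of_adj_closed {V : Type*} {G : SimpleGraph V} {A : Set V}
    (hA : ∀ x ∈ A, ∀ y, G.Adj x y → y ∈ A) {x y : V} (h : G.Reachable x y) (hx : x ∈ A) :
    y ∈ A := by
  obtain ⟨p⟩ := h
  induction p with
  | nil => exact hx
  | cons hadj _ ih => exact ih (hA _ hx _ hadj)

theorem Multiset.exists_of_map_eq_pair_add_replicate {α : Type*} {S : Multiset α} (hS : S.Nodup)
    {d : α → ℕ} {r s t : ℕ} (h : S.map d = {r, s} + Multiset.replicate t 1) :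
    ∃ x ∈ S, ∃ y ∈ S, x ≠ y ∧ d x = r ∧ d y = s ∧ ∀ z ∈ S, z ≠ x → z ≠ y → d z = 1 := by
  classical
  rw [Multiset.insert_eq_cons, Multiset.cons_add, ← Multiset.map_eq_cons] at h
  obtain ⟨x, hx, hxr, h⟩ := h
  rw [Multiset.singleton_add, ← Multiset.map_eq_cons] at h
  obtain ⟨y, hy, hys, h⟩ := h
  have hy' := (hS.mem_erase_iff).1 hy
  refine ⟨x, hx, y, hy'.2, hy'.1.symm, hxr, hys, fun z hz hzx hzy => ?_⟩
  refine Multiset.eq_of_mem_replicate (n := t) ?_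
  rw [← h]
  exact Multiset.mem_map_of_mem _
    (((hS.erase x).mem_erase_iff).2 ⟨hzy, (hS.mem_erase_iff).2 ⟨hzx, hz⟩⟩)

namespace BicolouredPlaneTree

open Equiv Equiv.Perm

variable {V : Type*} (T : BicolouredPlaneTree V)

/-- The white vertices of the tree. -/
abbrev White : Type _ := {v : V // T.colour v = false}

/-- The neighbours of a black vertex, as white vertices. -/
def neighborEquiv {v : V} (hv : T.colour v = true) :
    T.graph.neighborSet v ≃ {w : T.White // T.graph.Adj v w} where
  toFun w := ⟨⟨w, T.colour_white_end w.2 hv⟩, w.2⟩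
  invFun w := ⟨w.1, w.2⟩
  left_inv _ := rfl
  right_inv _ := rfl

open Classical in
/-- The rotation around a black vertex, as a permutation of all white vertices. -/
noncomputable def whitePerm {v : V} (hv : T.colour v = true) : Perm T.White :=
  (T.rot v).extendDomain (T.neighborEquiv hv)

theorem whitePerm_of_adj {v : V} (hv : T.colour v = true) {w : T.White}
    (h : T.graph.Adj v w) : (T.whitePerm hv w : V) = T.rot v ⟨w, h⟩ := by
  classical
  rw [whitePerm, extendDomain_apply_subtype (T.rot v) (T.neighborEquiv hv) h]
  rfl

theorem whitePerm_of_not_adj {v : V} (hv : T.colour v = true) {w : T.White}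
    (h : ¬ T.graph.Adj v w) : T.whitePerm hv w = w := by
  classical
  exact extendDomain_apply_not_subtype (T.rot v) (T.neighborEquiv hv) h

theorem isCycle_rot {v : V} (h : Nontrivial (T.graph.neighborSet v)) : (T.rot v).IsCycle :=
  isCycle_iff_exists_isCycleOn.2
    ⟨Set.univ, Set.nontrivial_univ, T.rot_isCycleOn v, fun _ _ => Set.mem_univ _⟩

theorem isCycle_whitePerm {v : V} (hv : T.colour v = true)
    (h : Nontrivial (T.graph.neighborSet v)) : (T.whitePerm hv).IsCycle := by
  classical
  exact (T.isCycle_rot h).extendDomain _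

theorem rot_ne {v : V} (h : Nontrivial (T.graph.neighborSet v)) (u : T.graph.neighborSet v) :
    T.rot v u ≠ u :=
  (T.rot_isCycleOn v).apply_ne Set.nontrivial_univ (Set.mem_univ u)

theorem whitePerm_ne_iff {v : V} (hv : T.colour v = true)
    (h : Nontrivial (T.graph.neighborSet v)) (w : T.White) :
    T.whitePerm hv w ≠ w ↔ T.graph.Adj v w := by
  constructor
  · intro hw
    by_contra hadj
    exact hw (T.whitePerm_of_not_adj hv hadj)
  · intro hadj hw
    refine T.rot_ne h ⟨w, hadj⟩ (Subtype.ext ?_)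
    rw [← T.whitePerm_of_adj hv hadj, hw]

/-- The parity of the degree enters here: the rotation is one cycle on exactly the neighbours of
`v`. -/
theorem sign_whitePerm [Fintype V] [DecidableEq V] {v : V} (hv : T.colour v = true)
    (h : Nontrivial (T.graph.neighborSet v)) :
    sign (T.whitePerm hv) = -(-1) ^ Nat.card (T.graph.neighborSet v) := by
  classical
  rw [(T.isCycle_whitePerm hv h).sign]
  congr 2
  rw [Nat.card_congr (T.neighborEquiv hv), Nat.card_eq_fintype_card, Fintype.card_subtype]
  congr 1
  ext w
  simp [T.whitePerm_ne_iff hv h]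

theorem rot_pow_apply_eq_iff {w : V} {d : ℕ} (h : Nat.card (T.graph.neighborSet w) = d)
    (hd : d ≠ 0) (u : T.graph.neighborSet w) (m n : ℕ) :
    (T.rot w ^ m) u = (T.rot w ^ n) u ↔ m ≡ n [MOD d] := by
  have : Finite (T.graph.neighborSet w) := Nat.finite_of_card_ne_zero (h ▸ hd)
  have := Fintype.ofFinite (T.graph.neighborSet w)
  have h1 := T.rot_isCycleOn w
  rw [← Finset.coe_univ] at h1
  rw [h1.pow_apply_eq_pow_apply (Finset.mem_univ u), Finset.card_univ,
    ← Nat.card_eq_fintype_card, h]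

theorem sigmaZero_eq_self_of_card_eq_one (e : T.Edge)
    (h : Nat.card (T.graph.neighborSet e.1.1) = 1) : T.sigmaZero e = e := by
  have := (Nat.card_eq_one_iff_unique.1 h).1
  refine Subtype.ext (Prod.ext rfl ?_)
  exact congrArg Subtype.val
    (Subsingleton.elim (T.rot e.1.1 ⟨e.1.2, e.2.1⟩) ⟨e.1.2, e.2.1⟩)

/-- The edges of the tree can be labelled by pairs (white vertex, layer) in such a way that
`σ₁` moves every layer to the next one and `σ₀` preserves the layers. -/
theorem exists_labelling [Finite V] {v₀ v₁ : V} (hb₀ : T.colour v₀ = true)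
    (hb₁ : T.colour v₁ = true)
    (hleaf : ∀ v, T.colour v = true → v ≠ v₀ → v ≠ v₁ → Nat.card (T.graph.neighborSet v) = 1)
    (hwhite : ∀ w, T.colour w = false → Nat.card (T.graph.neighborSet w) = 3)
    (hcard : Nat.card T.Edge = 3 * Nat.card T.White)
    (hcov : ∀ w, T.colour w = false → T.graph.Adj w v₀ ∨ T.graph.Adj w v₁)
    (hrot : ∀ w (h₀ : T.graph.Adj w v₀), T.graph.Adj w v₁ → (T.rot w ⟨v₀, h₀⟩ : V) = v₁) :
    ∃ Φ : T.White × Fin 3 ≃ T.Edge,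
      (∀ x, Φ (wreathPerm ![T.whitePerm hb₀, T.whitePerm hb₁, 1] 0 x) = T.sigmaZero (Φ x)) ∧
      (∀ x, Φ (wreathPerm 1 1 x) = T.sigmaOne (Φ x)) := by
  -- The layer-0 neighbour of a white vertex is v₀ if adjacent, and otherwise the predecessor of v₁;
  -- at a common neighbour `hrot` makes both conditions hold.
  have hbase : ∀ w : T.White, ∃ u : T.graph.neighborSet w,
      (T.graph.Adj w v₀ → (u : V) = v₀) ∧ (T.graph.Adj w v₁ → (T.rot w u : V) = v₁) := by
    intro w
    by_cases h₀ : T.graph.Adj w v₀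
    · exact ⟨⟨v₀, h₀⟩, fun _ => rfl, hrot w h₀⟩
    · refine ⟨(T.rot w).symm ⟨v₁, (hcov w w.2).resolve_left h₀⟩, fun h => absurd h h₀, fun _ => ?_⟩
      rw [apply_symm_apply]
  choose base hbase₀ hbase₁ using hbase
  let pos : (w : T.White) → Fin 3 → T.graph.neighborSet w.1 := fun w i => (T.rot w ^ i.1) (base w)
  have hpos_inj : ∀ w i j, (pos w i : V) = pos w j → i = j := by
    intro w i j h
    have := (T.rot_pow_apply_eq_iff (hwhite w w.2) three_ne_zero _ _ _).1 (Subtype.ext h)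
    exact Fin.ext (Nat.ModEq.eq_of_lt_of_lt this i.2 j.2)
  have hpos_succ : ∀ w i, pos w (i + 1) = T.rot w (pos w i) := by
    intro w i
    change _ = T.rot w ((T.rot w ^ i.1) (base w))
    rw [← Perm.mul_apply, ← pow_succ']
    refine (T.rot_pow_apply_eq_iff (hwhite w w.2) three_ne_zero _ _ _).2 ?_
    fin_cases i <;> rfl
  have hpos₀ : ∀ w, T.graph.Adj w.1 v₀ → (pos w 0 : V) = v₀ := hbase₀
  have hpos₁ : ∀ w, T.graph.Adj w.1 v₁ → (pos w 1 : V) = v₁ := hbase₁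
  let Φ : T.White × Fin 3 → T.Edge := fun x => ⟨(pos x.1 x.2, x.1),
    SimpleGraph.Adj.symm (pos x.1 x.2).2, T.colour_black_end (pos x.1 x.2).2 x.1.2⟩
  have hΦ_inj : Function.Injective Φ := by
    rintro ⟨w, i⟩ ⟨w', i'⟩ h
    have h1 := congrArg Subtype.val h
    obtain rfl : w = w' := Subtype.ext (congrArg Prod.snd h1)
    rw [hpos_inj w i i' (congrArg Prod.fst h1)]
  have hfin : Finite T.Edge := Subtype.finite
  have hΦ : Function.Bijective Φ := by
    rw [Nat.bijective_iff_injective_and_card]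
    exact ⟨hΦ_inj, by rw [hcard, Nat.card_prod, Nat.card_fin, mul_comm]⟩
  refine ⟨Equiv.ofBijective Φ hΦ, ?_, ?_⟩
  -- If all edges at `v` lie in layer `i`, turning around `v` changes only the white end.
  · have hlayer : ∀ (v : V) (hv : T.colour v = true) (i : Fin 3)
        (_ : ∀ w, T.graph.Adj w.1 v → (pos w i : V) = v) (w : T.White),
        T.graph.Adj w.1 v → Φ (T.whitePerm hv w, i) = T.sigmaZero (Φ (w, i)) := by
      intro v hv i hi w hw
      have h1 : Φ (w, i) = ⟨(v, w), hw.symm, hv⟩ := Subtype.ext (Prod.ext (hi w hw) rfl)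
      have h2 := T.whitePerm_of_adj hv hw.symm
      rw [h1]
      refine Subtype.ext (Prod.ext (hi _ ?_) h2)
      rw [h2]
      exact SimpleGraph.Adj.symm (T.rot v ⟨w, hw.symm⟩).2
    have hfixed : ∀ w i, (pos w i : V) ≠ v₀ → (pos w i : V) ≠ v₁ →
        T.sigmaZero (Φ (w, i)) = Φ (w, i) := fun w i h₀ h₁ =>
      T.sigmaZero_eq_self_of_card_eq_one _ (hleaf _ (Φ (w, i)).2.2 h₀ h₁)
    have hpos₀' : ∀ w i, (pos w i : V) = v₀ → i = 0 ∧ T.graph.Adj w.1 v₀ := by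
      intro w i h
      have hadj : T.graph.Adj w.1 v₀ := h ▸ (pos w i).2
      exact ⟨hpos_inj w i 0 (h.trans (hpos₀ w hadj).symm), hadj⟩
    have hpos₁' : ∀ w i, (pos w i : V) = v₁ → i = 1 ∧ T.graph.Adj w.1 v₁ := by
      intro w i h
      have hadj : T.graph.Adj w.1 v₁ := h ▸ (pos w i).2
      exact ⟨hpos_inj w i 1 (h.trans (hpos₁ w hadj).symm), hadj⟩
    rintro ⟨w, i⟩
    change Φ (![T.whitePerm hb₀, T.whitePerm hb₁, 1] i w, i + 0) = T.sigmaZero (Φ (w, i))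
    rw [add_zero]
    fin_cases i
    · by_cases h : T.graph.Adj w.1 v₀
      · exact hlayer v₀ hb₀ 0 hpos₀ w h
      · exact (congrArg (fun u => Φ (u, 0)) (T.whitePerm_of_not_adj hb₀ fun h' => h h'.symm)).trans
          (hfixed w 0 (fun h' => h (hpos₀' _ _ h').2)
            fun h' => absurd (hpos₁' _ _ h').1 (by decide)).symm
    · by_cases h : T.graph.Adj w.1 v₁
      · exact hlayer v₁ hb₁ 1 hpos₁ w h
      · exact (congrArg (fun u => Φ (u, 1)) (T.whitePerm_of_not_adj hb₁ fun h' => h h'.symm)).trans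
          (hfixed w 1 (fun h' => absurd (hpos₀' _ _ h').1 (by decide))
            fun h' => h (hpos₁' _ _ h').2).symm
    -- Layer 2 contains only edges to leaves, which σ₀ fixes.
    · exact (hfixed w 2 (fun h' => absurd (hpos₀' _ _ h').1 (by decide))
        fun h' => absurd (hpos₁' _ _ h').1 (by decide)).symm
  · rintro ⟨w, i⟩
    refine Subtype.ext (Prod.ext ?_ rfl)
    exact congrArg Subtype.val (hpos_succ w i)

/-- A labelling of the edges that carries `x`, `y` to `σ₀`, `σ₁` identifies the monodromy group with
the group generated by `x` and `y`. -/
theorem nonempty_monodromyGroup_mulEquiv {X : Type*} {x y : Perm X} (Φ : X ≃ T.Edge)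
    (hx : ∀ z, Φ (x z) = T.sigmaZero (Φ z)) (hy : ∀ z, Φ (y z) = T.sigmaOne (Φ z)) :
    Nonempty (T.monodromyGroup ≃* Subgroup.closure {x, y}) := by
  have hx' : Φ.permCongrHom x = T.sigmaZero := by
    ext1 e
    simp [Equiv.permCongr_apply, hx]
  have hy' : Φ.permCongrHom y = T.sigmaOne := by
    ext1 e
    simp [Equiv.permCongr_apply, hy]
  have h : (Subgroup.closure {x, y}).map (Φ.permCongrHom : Perm X →* Perm T.Edge) =
      T.monodromyGroup := by
    rw [MonoidHom.map_closure, Set.image_pair, monodromyGroup]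
    exact congrArg₂ (fun s t => Subgroup.closure {s, t}) hx' hy'
  exact ⟨((Φ.permCongrHom.subgroupMap (Subgroup.closure {x, y})).trans
    (MulEquiv.subgroupCongr h)).symm⟩

/-- Every white vertex is adjacent to one of the two black vertices that are not leaves. -/
theorem adj_or_adj_of_white {v₀ v₁ : V} (hb₀ : T.colour v₀ = true)
    (hleaf : ∀ v, T.colour v = true → v ≠ v₀ → v ≠ v₁ → Nat.card (T.graph.neighborSet v) = 1)
    {w : V} (hw : T.colour w = false) : T.graph.Adj w v₀ ∨ T.graph.Adj w v₁ := by
  by_contra! h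
  -- If all neighbours of `w` are leaves, `w` and its neighbours are closed under adjacency, and
  -- connectedness puts v₀ among them.
  have hA : ∀ x ∈ insert w (T.graph.neighborSet w), ∀ y, T.graph.Adj x y →
      y ∈ insert w (T.graph.neighborSet w) := by
    rintro x (rfl | hx) y hxy
    · exact Or.inr hxy
    · left
      have hx1 := hleaf x (T.colour_black_end hx hw) (fun h' => h.1 (h' ▸ hx))
        (fun h' => h.2 (h' ▸ hx))
      have := (Nat.card_eq_one_iff_unique.1 hx1).1
      exact congrArg Subtype.val (Subsingleton.elim (⟨y, hxy⟩ : T.graph.neighborSet x)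
        ⟨w, hx.symm⟩)
  rcases (T.isTree.connected.preconnected w v₀).mem_of_adj_closed hA (Set.mem_insert _ _) with
    h' | h'
  · rw [h', hw] at hb₀
    exact absurd hb₀ (by decide)
  · exact h.1 h'

/-- The two black vertices that are not leaves have exactly one common neighbour. -/
theorem exists_unique_common_neighbor [Fintype V] {v₀ v₁ : V} (hb₀ : T.colour v₀ = true)
    (hb₁ : T.colour v₁ = true)
    (hcov : ∀ w, T.colour w = false → T.graph.Adj w v₀ ∨ T.graph.Adj w v₁)
    (hcard : Nat.card (T.graph.neighborSet v₀) + Nat.card (T.graph.neighborSet v₁) =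
      Nat.card T.White + 1) :
    ∃ c : T.White, T.graph.Adj v₀ c ∧ T.graph.Adj v₁ c ∧
      ∀ w, T.graph.Adj v₀ w → T.graph.Adj v₁ w → w = c := by
  classical
  have h0 : ∀ v, Nat.card (T.graph.neighborSet v) = (T.graph.neighborFinset v).card := fun v => by
    rw [Nat.card_eq_fintype_card, SimpleGraph.card_neighborSet_eq_degree]; rfl
  have hunion : T.graph.neighborFinset v₀ ∪ T.graph.neighborFinset v₁ =
      Finset.univ.filter fun w => T.colour w = false := by
    ext w
    simp only [Finset.mem_union, SimpleGraph.mem_neighborFinset, Finset.mem_filter,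
      Finset.mem_univ, true_and]
    constructor
    · rintro (h | h)
      · exact T.colour_white_end h hb₀
      · exact T.colour_white_end h hb₁
    · intro h
      exact (hcov w h).imp SimpleGraph.Adj.symm SimpleGraph.Adj.symm
  have h1 := Finset.card_union_add_card_inter (T.graph.neighborFinset v₀)
    (T.graph.neighborFinset v₁)
  rw [hunion, ← Fintype.card_subtype, ← Nat.card_eq_fintype_card, ← h0, ← h0, hcard,
    add_right_inj, Finset.card_eq_one] at h1
  obtain ⟨c, hc⟩ := h1
  have hmem : ∀ w, (T.graph.Adj v₀ w ∧ T.graph.Adj v₁ w) ↔ w = c := fun w => by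
    rw [← Finset.mem_singleton, ← hc]; simp
  obtain ⟨hc₀, hc₁⟩ := (hmem c).2 rfl
  exact ⟨⟨c, T.colour_white_end hc₀ hb₀⟩, hc₀, hc₁, fun w h h' => (hmem w).1 ⟨h, h'⟩⟩

/-- The three forms of the monodromy group, according to the parities of the degrees of the two
black vertices `v₀`, `v₁` that are not leaves, when `v₁` follows `v₀` around their common
neighbour. -/
theorem isSemidirectProductOf_monodromyGroup [Fintype V] {p : ℕ} {v₀ v₁ : V}
    (hb₀ : T.colour v₀ = true) (hb₁ : T.colour v₁ = true)
    (hleaf : ∀ v, T.colour v = true → v ≠ v₀ → v ≠ v₁ → Nat.card (T.graph.neighborSet v) = 1)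
    (hwhite : ∀ w, T.colour w = false → Nat.card (T.graph.neighborSet w) = 3)
    (hp : Nat.card T.White = p) (hedge : Nat.card T.Edge = 3 * p)
    (h₀ : 2 ≤ Nat.card (T.graph.neighborSet v₀)) (h₁ : 2 ≤ Nat.card (T.graph.neighborSet v₁))
    {c : T.White} (hc₀ : T.graph.Adj v₀ c) (hc₁ : T.graph.Adj v₁ c)
    (hc : ∀ w, T.graph.Adj v₀ w → T.graph.Adj v₁ w → w = c)
    (hrot : (T.rot c ⟨v₀, hc₀.symm⟩ : V) = v₁) :
    (Even (Nat.card (T.graph.neighborSet v₀)) ∧ Even (Nat.card (T.graph.neighborSet v₁)) →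
      IsSemidirectProductOf T.monodromyGroup
        (Fin 3 → alternatingGroup (Fin p)) (alternatingGroup (Fin 4))) ∧
    (Odd (Nat.card (T.graph.neighborSet v₀)) ∧ Odd (Nat.card (T.graph.neighborSet v₁)) →
      IsSemidirectProductOf T.monodromyGroup
        (Fin 3 → alternatingGroup (Fin p)) (Multiplicative (ZMod 3))) ∧
    (¬ (Even (Nat.card (T.graph.neighborSet v₀)) ↔ Even (Nat.card (T.graph.neighborSet v₁))) →
      IsSemidirectProductOf T.monodromyGroup
        (Fin 3 → alternatingGroup (Fin p))
        (alternatingGroup (Fin 4) × Multiplicative (ZMod 2))) := by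
  classical
  have hn₀ : Nontrivial (T.graph.neighborSet v₀) := Finite.one_lt_card_iff_nontrivial.1 h₀
  have hn₁ : Nontrivial (T.graph.neighborSet v₁) := Finite.one_lt_card_iff_nontrivial.1 h₁
  have hcov : ∀ w, T.colour w = false → T.graph.Adj w v₀ ∨ T.graph.Adj w v₁ :=
    fun w hw => T.adj_or_adj_of_white hb₀ hleaf hw
  obtain ⟨Φ, hΦ₀, hΦ₁⟩ := T.exists_labelling hb₀ hb₁ hleaf hwhite (by rw [hedge, hp]) hcov
    (by
      intro w hw₀ hw₁
      obtain rfl := hc w hw₀.symm hw₁.symm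
      exact hrot)
  obtain ⟨e⟩ := T.nonempty_monodromyGroup_mulEquiv Φ hΦ₀ hΦ₁
  rw [Nat.card_eq_fintype_card] at hp
  let f : (Fin 3 → alternatingGroup T.White) ≃* (Fin 3 → alternatingGroup (Fin p)) :=
    MulEquiv.piCongrRight fun _ => (Fintype.equivFinOfCardEq hp).altCongrHom
  have hne₀ := T.whitePerm_ne_iff hb₀ hn₀
  have hne₁ := T.whitePerm_ne_iff hb₁ hn₁
  have ha := T.isCycle_whitePerm hb₀ hn₀
  have hb := T.isCycle_whitePerm hb₁ hn₁
  have hac := (hne₀ c).2 hc₀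
  have hbc := (hne₁ c).2 hc₁
  have hab : ∀ z, T.whitePerm hb₀ z ≠ z → T.whitePerm hb₁ z ≠ z → z = c := fun z hz₀ hz₁ =>
    Subtype.ext (hc z ((hne₀ z).1 hz₀) ((hne₁ z).1 hz₁))
  have hcov' : ∀ z, T.whitePerm hb₀ z ≠ z ∨ T.whitePerm hb₁ z ≠ z := fun z =>
    (hcov z z.2).imp (fun h => (hne₀ z).2 h.symm) fun h => (hne₁ z).2 h.symm
  have hs₀ := T.sign_whitePerm hb₀ hn₀
  have hs₁ := T.sign_whitePerm hb₁ hn₁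
  refine ⟨fun h => ?_, fun h => ?_, fun h => ?_⟩
  · rw [h.1.neg_one_pow] at hs₀
    rw [h.2.neg_one_pow] at hs₁
    exact (isSemidirectProductOf_of_sign_eq_neg_one ha hb hac hbc hab hcov' hs₀ hs₁).congr e f
  · rw [h.1.neg_one_pow, neg_neg] at hs₀
    rw [h.2.neg_one_pow, neg_neg] at hs₁
    exact (isSemidirectProductOf_of_sign_eq_one ha hb hac hbc hab hcov' hs₀ hs₁).congr e f
  · refine (isSemidirectProductOf_of_sign_ne ha hb hac hbc hab hcov' ?_).congr e f
    rw [hs₀, hs₁]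
    rcases Nat.even_or_odd (Nat.card (T.graph.neighborSet v₀)) with h0 | h0 <;>
    rcases Nat.even_or_odd (Nat.card (T.graph.neighborSet v₁)) with h1 | h1
    · exact absurd (iff_of_true h0 h1) h
    · rw [h0.neg_one_pow, h1.neg_one_pow]; decide
    · rw [h0.neg_one_pow, h1.neg_one_pow]; decide
    · exact absurd (iff_of_false (Nat.not_even_iff_odd.2 h0) (Nat.not_even_iff_odd.2 h1)) h

end BicolouredPlaneTree

theorem mainTheorem5 {V : Type*} [Fintype V] (T : BicolouredPlaneTree V)
    (r s t p n : ℕ) (hr : 2 ≤ r) (hs : 2 ≤ s)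
    (hnp : n = 3 * p) (hn : n = r + s + t) (htree : p + t + 2 = n + 1)
    (hT : T.HasPassport ({r, s} + Multiset.replicate t 1) (Multiset.replicate p 3) n) :
    (Even r ∧ Even s →
      IsSemidirectProductOf T.monodromyGroup
        (Fin 3 → alternatingGroup (Fin p)) (alternatingGroup (Fin 4))) ∧
    (Odd r ∧ Odd s →
      IsSemidirectProductOf T.monodromyGroup
        (Fin 3 → alternatingGroup (Fin p)) (Multiplicative (ZMod 3))) ∧
    (¬ (Even r ↔ Even s) →
      IsSemidirectProductOf T.monodromyGroup
        (Fin 3 → alternatingGroup (Fin p))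
        (alternatingGroup (Fin 4) × Multiplicative (ZMod 2))) := by
  classical
  obtain ⟨hblack, hwhite, hedge⟩ := hT
  rw [BicolouredPlaneTree.degrees] at hblack hwhite
  obtain ⟨v₀, hv₀, v₁, hv₁, hne, hd₀, hd₁, hd⟩ :=
    Multiset.exists_of_map_eq_pair_add_replicate (Finset.nodup _) hblack
  have hdeg : ∀ v, Nat.card (T.graph.neighborSet v) = T.graph.degree v := fun v => by
    rw [Nat.card_eq_fintype_card, SimpleGraph.card_neighborSet_eq_degree]
  simp only [Finset.mem_val, Finset.mem_filter, Finset.mem_univ, true_and] at hv₀ hv₁ hd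
  have hp : Nat.card T.White = p := by
    have h := congrArg Multiset.card hwhite
    rw [Multiset.card_map, Multiset.card_replicate] at h
    rw [Nat.card_eq_fintype_card, Fintype.card_subtype]
    exact h
  have hw3 : ∀ w, T.colour w = false → Nat.card (T.graph.neighborSet w) = 3 := by
    intro w hw
    refine Multiset.eq_of_mem_replicate (n := p) ?_
    rw [← hwhite, hdeg]
    exact Multiset.mem_map_of_mem (fun v => T.graph.degree v) (by simpa using hw)
  have hleaf : ∀ v, T.colour v = true → v ≠ v₀ → v ≠ v₁ →
      Nat.card (T.graph.neighborSet v) = 1 := fun v hv h h' => by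
    rw [hdeg]; exact hd v hv h h'
  rw [← hdeg] at hd₀ hd₁
  -- The two expressions for `n` give r + s = p + 1.
  obtain ⟨c, hc₀, hc₁, hc⟩ := T.exists_unique_common_neighbor hv₀ hv₁
    (fun w hw => T.adj_or_adj_of_white hv₀ hleaf hw) (by omega)
  have hedge' : Nat.card T.Edge = 3 * p := hedge.trans hnp
  obtain ⟨k, hk⟩ : ∃ k : Fin 3, (T.rot c ^ k.1) ⟨v₀, hc₀.symm⟩ = ⟨v₁, hc₁.symm⟩ := by
    obtain ⟨m, hm⟩ := (T.rot_isCycleOn c).exists_pow_eq' Set.finite_univ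
      (Set.mem_univ ⟨v₀, hc₀.symm⟩) (Set.mem_univ ⟨v₁, hc₁.symm⟩)
    refine ⟨⟨m % 3, Nat.mod_lt _ (by decide)⟩, ?_⟩
    rw [← hm, T.rot_pow_apply_eq_iff (hw3 c c.2) three_ne_zero]
    exact Nat.mod_modEq m 3
  subst hd₀ hd₁
  -- v₁ comes `k` steps after v₀ around `c`. The case 0 would make them equal; in case 2, v₀
  -- directly follows v₁ and the two exchange roles.
  fin_cases k
  · exact absurd (congrArg Subtype.val hk) hne
  · exact T.isSemidirectProductOf_monodromyGroup hv₀ hv₁ hleaf hw3 hp hedge' hr hs hc₀ hc₁ hc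
      (congrArg Subtype.val hk)
  · have hrot : T.rot c ⟨v₁, hc₁.symm⟩ = ⟨v₀, hc₀.symm⟩ := by
      rw [← hk]
      exact (T.rot_pow_apply_eq_iff (hw3 c c.2) three_ne_zero _ 3 0).2 rfl
    obtain ⟨h₁, h₂, h₃⟩ := T.isSemidirectProductOf_monodromyGroup hv₁ hv₀
      (fun v hv h h' => hleaf v hv h' h) hw3 hp hedge' hs hr hc₁ hc₀
      (fun w h h' => hc w h' h) (congrArg Subtype.val hrot)
    exact ⟨fun h => h₁ h.symm, fun h => h₂ h.symm, fun h => h₃ fun h' => h h'.symm⟩
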